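/- All graphs are finite and simple. For a graph $G$ and a vertex $v$, the local complementation $G*v$ is the graph obtained from $G$ by replacing the subgraph induced on the neighbourhood $N(v)$ by its complement. For an edge $uv$ of $G$, the pivot of $G$ at $uv$ is the graph $G\times uv := G*u*v*u$ (which equals $G*v*u*v$). A graph $H$ with $V(H)\subseteq V(G)$ is a pivot-minor of $G$ if $H$ itself (with its vertex labels, not just up to isomorphism) can be obtained from $G$ by a finite sequence of pivots at edges and vertex deletions. A graph $G$ is $k$-pivot-minor universal if for every $U\subseteq V(G)$ with $|U|=k$, every graph $H$ with vertex set $U$ is a pivot-minor of $G$. Let $\mathbb{G}(n,1/2)$ denote the random graph on vertex set $[n]$ in which each edge is present independently with probability $1/2$. **Theorem.** For every real $c>0$ there is a function $\varepsilon=\varepsilon_c:\mathbb{N}\to\mathbb{R}$ with $\varepsilon(k)\to 0$ as $k\to\infty$ such that, for all non-negative integers $k$ and $n$ with $$n\ \ge\ (1+c)\,\frac{2}{\log_2(16/13)}\,k^2 ,$$ a random graph $G\sim\mathbb{G}(n,1/2)$ satisfies $$\mathbb{P}\big[G\text{ is }k\text{-pivot-minor universal}\big]\ \ge\ 1-2^{-(1+\varepsilon(k))\,c\,k^2}.$$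 (Here $2/\log_2(16/13)\approx 6.68$.) -/

import Mathlib

namespace SimpleGraph

/-- The local complementation `G * v`: the adjacency of two distinct vertices is flipped exactly
when both of them are neighbours of `v`. -/
def localComplement {V : Type*} (G : SimpleGraph V) (v : V) : SimpleGraph V where
  Adj x y := x ≠ y ∧ Xor (G.Adj x y) (G.Adj v x ∧ G.Adj v y)
  symm := ⟨fun x y h => ⟨h.1.symm, by simpa only [G.adj_comm y x, and_comm] using h.2⟩⟩
  loopless := ⟨fun _ h => h.1 rfl⟩

/-- The pivot `G × uv = G * u * v * u`; it is used only at edges `uv` of `G`. -/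
def pivot {V : Type*} (G : SimpleGraph V) (u v : V) : SimpleGraph V :=
  ((G.localComplement u).localComplement v).localComplement u

/-- `G.IsPivotMinor W H`, for a graph `H` whose vertex set is the set `W` of vertices of `G`:
the graph `H` is obtained from `G`, exactly and with its labels, by a finite sequence of pivots at
edges and deletions of vertices. -/
inductive IsPivotMinor {V : Type*} (G : SimpleGraph V) : (W : Set V) → SimpleGraph W → Prop
  | refl : IsPivotMinor G Set.univ (G.induce Set.univ)
  | pivot {W : Set V} {H : SimpleGraph W} (hH : IsPivotMinor G W H) (u v : W) (huv : H.Adj u v) :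
      IsPivotMinor G W (H.pivot u v)
  | delete {W : Set V} {H : SimpleGraph W} (hH : IsPivotMinor G W H) (v : V) (hv : v ∈ W) :
      IsPivotMinor G (W \ {v}) (H.comap (Set.inclusion Set.sdiff_subset))

/-- Every graph on every set of exactly `k` vertices of `G` is a pivot-minor of `G`. -/
def IsPivotMinorUniversal {V : Type*} (G : SimpleGraph V) (k : ℕ) : Prop :=
  ∀ U : Set V, U.encard = k → ∀ H : SimpleGraph U, G.IsPivotMinor U H

end SimpleGraph

/-- The probability `1/2` as an element of the unit interval. -/
noncomputable def oneHalf : unitInterval := ⟨1 / 2, by norm_num, by norm_num⟩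

section

open Finset symmDiff
open scoped Classical

/-! Fix `U` and `H`, choose `⌊(n - k) / 2⌋` disjoint pairs outside `U`, and use up the pairs one at
a time: pivot at the pair or not (only if it is an edge), then delete both vertices. Let `q` be the
fraction of graphs for which no sequence of choices leaves `H` on `U`.

Adding a pair `vw` costs little. Off `v, w`, pivoting adds the alternating form `N(v) ∧ N(w)` over
the field with two elements, and `N(v)`, `N(w)` are uniform and independent of the rest of the graph
(`sum_resample`). Adding a random `b ∧ b'` is a random walk on graphs whose nontrivial eigenvalues
are at most `1/2`, so a graph and its pivot are both bad with probability at most `(q + q²)/2`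
(`sum_mul_symmDiff_wedge_le`). As `vw` is an edge with probability `1/2`, the new fraction is at
most `q/2 + (q + q²)/4` (`card_filter_not_pairReaches_cons`).

Hence each pair multiplies the odds `q/(1 - q)` by at most `4/5`, starting from odds below `2 ^
k.choose 2`. A union bound over `U` and `H` leaves `n ^ k * 2 ^ (k²) * (4/5) ^ ⌊(n - k)/2⌋` as an
upper bound; since `5/4 > 16/13`, the hypothesis on `n` has enough slack to absorb `n ^ k` and the
rounding once `k` is large. -/

theorem Fintype.sum_comp_symmDiff {α : Type*} [GeneralizedBooleanAlgebra α] [Fintype α]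
    (g : α → ℝ) (e : α) : ∑ x, g (x ∆ e) = ∑ x, g x :=
  Equiv.sum_comp (symmDiff_left_involutive e).toPerm g

namespace SimpleGraph

/-! ### Fourier analysis on the group of graphs, and the spectral gap -/

section Fourier

variable {V : Type*}

theorem symmDiff_adj (G H : SimpleGraph V) (x y : V) :
    (G ∆ H).Adj x y ↔ Xor (G.Adj x y) (H.Adj x y) := by
  simp only [symmDiff_def, sup_adj, sdiff_adj, xor_def]

/-- The graph of the alternating form `b ∧ b'` over the field with two elements. -/
def wedge (b b' : Set V) : SimpleGraph V where
  Adj x y := x ≠ y ∧ Xor (x ∈ b ∧ y ∈ b') (x ∈ b' ∧ y ∈ b)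
  symm := ⟨fun x y h => ⟨h.1.symm, by
    have := h.2
    simp only [xor_def] at *
    tauto⟩⟩
  loopless := ⟨fun _ h => h.1 rfl⟩

theorem wedge_adj (b b' : Set V) (x y : V) :
    (wedge b b').Adj x y ↔ x ≠ y ∧ Xor (x ∈ b ∧ y ∈ b') (x ∈ b' ∧ y ∈ b) := Iff.rfl

theorem wedge_symmDiff_right (b c d : Set V) : wedge b (c ∆ d) = wedge b c ∆ wedge b d := by
  ext x y
  simp only [symmDiff_adj, wedge_adj, Set.mem_symmDiff, xor_def]
  by_cases h1 : x ∈ b <;> by_cases h2 : y ∈ b <;> by_cases h3 : x ∈ c <;> by_cases h4 : y ∈ c <;>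
    by_cases h5 : x ∈ d <;> by_cases h6 : y ∈ d <;> simp [h1, h2, h3, h4, h5, h6]

theorem wedge_symmDiff_left (b c d : Set V) : wedge (b ∆ c) d = wedge b d ∆ wedge c d := by
  ext x y
  simp only [symmDiff_adj, wedge_adj, Set.mem_symmDiff, xor_def]
  by_cases h1 : x ∈ b <;> by_cases h2 : y ∈ b <;> by_cases h3 : x ∈ c <;> by_cases h4 : y ∈ c <;>
    by_cases h5 : x ∈ d <;> by_cases h6 : y ∈ d <;> simp [h1, h2, h3, h4, h5, h6]

theorem wedge_singleton {x y : V} : wedge {x} {y} = edge x y := by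
  ext a b
  simp only [wedge_adj, edge_adj, Set.mem_singleton_iff, xor_def]
  grind

variable [Fintype V]

/-- The character of the group of graphs on `V` under symmetric difference given by `T`. -/
noncomputable def edgeChar (T G : SimpleGraph V) : ℝ :=
  ∏ e : Sym2 V, if e ∈ T.edgeSet ∧ e ∈ G.edgeSet then -1 else 1

theorem edgeChar_comm (T G : SimpleGraph V) : edgeChar T G = edgeChar G T := by
  refine Finset.prod_congr rfl fun e _ => ?_
  exact if_congr and_comm rfl rfl

theorem edgeChar_symmDiff (T G H : SimpleGraph V) :
    edgeChar T (G ∆ H) = edgeChar T G * edgeChar T H := by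
  rw [edgeChar, edgeChar, edgeChar, ← Finset.prod_mul_distrib]
  refine Finset.prod_congr rfl fun e _ => ?_
  induction e with
  | _ x y =>
    simp only [mem_edgeSet, symmDiff_adj, xor_def]
    by_cases h1 : T.Adj x y <;> by_cases h2 : G.Adj x y <;> by_cases h3 : H.Adj x y <;>
      simp [h1, h2, h3]

theorem edgeChar_bot (T : SimpleGraph V) : edgeChar T ⊥ = 1 := by
  simp [edgeChar]

theorem edgeChar_mul_self (T G : SimpleGraph V) : edgeChar T G * edgeChar T G = 1 := by
  rw [← edgeChar_symmDiff, symmDiff_self, edgeChar_bot]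

theorem edgeChar_eq_or (T G : SimpleGraph V) : edgeChar T G = 1 ∨ edgeChar T G = -1 :=
  mul_self_eq_one_iff.1 (edgeChar_mul_self T G)

theorem edgeChar_edge (T : SimpleGraph V) {x y : V} (h : T.Adj x y) :
    edgeChar T (edge x y) = -1 := by
  rw [edgeChar, Finset.prod_eq_single s(x, y)]
  · simp [h, h.ne]
  · intro e _ he
    rw [if_neg]
    rintro ⟨-, h2⟩
    rw [edgeSet_edge_of_ne h.ne] at h2
    exact he h2
  · simp

theorem sum_edgeChar {G : SimpleGraph V} (hG : G ≠ ⊥) : ∑ T, edgeChar T G = 0 := by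
  obtain ⟨x, y, h⟩ := ne_bot_iff_exists_adj.1 hG
  have := Fintype.sum_comp_symmDiff (fun T => edgeChar T G) (edge x y)
  simp only [edgeChar_comm _ G, edgeChar_symmDiff, edgeChar_edge G h, mul_neg, mul_one,
    Finset.sum_neg_distrib] at this ⊢
  linarith

/-- Autocorrelation as the transform of the power spectrum; `D = ⊥` is Parseval's identity. -/
theorem sum_edgeChar_mul_sq (f : SimpleGraph V → ℝ) (D : SimpleGraph V) :
    ∑ T, edgeChar T D * (∑ G, f G * edgeChar T G) ^ 2 =
      Fintype.card (SimpleGraph V) * ∑ G, f G * f (G ∆ D) := by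
  have h1 : ∀ T : SimpleGraph V, edgeChar T D * (∑ G, f G * edgeChar T G) ^ 2 =
      ∑ G, ∑ H, f G * f H * edgeChar T (G ∆ D ∆ H) := by
    intro T
    rw [sq, Finset.sum_mul_sum, Finset.mul_sum]
    refine Finset.sum_congr rfl fun G _ => ?_
    rw [Finset.mul_sum]
    refine Finset.sum_congr rfl fun H _ => ?_
    rw [edgeChar_symmDiff, edgeChar_symmDiff]
    ring
  simp only [h1]
  rw [Finset.sum_comm, Finset.mul_sum]
  refine Finset.sum_congr rfl fun G _ => ?_
  rw [Finset.sum_comm, Finset.sum_eq_single (G ∆ D)]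
  · simp only [symmDiff_self, edgeChar_bot, mul_one, Finset.sum_const, Finset.card_univ,
      nsmul_eq_mul]
  · intro H _ hH
    rw [← Finset.mul_sum, sum_edgeChar, mul_zero]
    rwa [ne_eq, symmDiff_eq_bot, eq_comm]
  · simp

theorem sum_edgeChar_wedge_right (T : SimpleGraph V) (b : Set V) {y : V}
    (h : edgeChar T (wedge b {y}) = -1) : ∑ b', edgeChar T (wedge b b') = 0 := by
  have := Fintype.sum_comp_symmDiff (fun b' => edgeChar T (wedge b b')) {y}
  simp only [wedge_symmDiff_right, edgeChar_symmDiff, h, mul_neg, mul_one,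
    Finset.sum_neg_distrib] at this
  linarith

theorem sum_edgeChar_wedge_right_le (T : SimpleGraph V) (b : Set V) :
    ∑ b', edgeChar T (wedge b b') ≤ Fintype.card (Set V) := by
  calc ∑ b', edgeChar T (wedge b b') ≤ ∑ _b' : Set V, (1 : ℝ) := by
        refine Finset.sum_le_sum fun b' _ => ?_
        rcases edgeChar_eq_or T (wedge b b') with h | h <;> norm_num [h]
    _ = _ := by simp

/-- The inner sum over `b'` vanishes unless `b` pairs trivially with every singleton `{y}`. If `xy`
is an edge of `T`, translating `b` by `{x}` flips the sign at `{y}`, so at most one of `b` and `b ∆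
{x}` contributes. -/
theorem sum_edgeChar_wedge {T : SimpleGraph V} (hT : T ≠ ⊥) :
    ∑ b, ∑ b', edgeChar T (wedge b b') ≤ (Fintype.card (Set V) : ℝ) ^ 2 / 2 := by
  obtain ⟨x, y, h⟩ := ne_bot_iff_exists_adj.1 hT
  set g : Set V → ℝ := fun b => ∑ b', edgeChar T (wedge b b') with hg
  have h0 := Fintype.sum_comp_symmDiff g {x}
  have h1 : ∀ b, g (b ∆ {x}) + g b ≤ Fintype.card (Set V) := by
    intro b
    rcases edgeChar_eq_or T (wedge b {y}) with h2 | h2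
    · have : g (b ∆ {x}) = 0 := by
        refine sum_edgeChar_wedge_right T _ (y := y) ?_
        rw [wedge_symmDiff_left, edgeChar_symmDiff, h2, wedge_singleton, edgeChar_edge T h, one_mul]
      rw [this, zero_add]
      exact sum_edgeChar_wedge_right_le T b
    · have : g b = 0 := sum_edgeChar_wedge_right T _ h2
      rw [this, add_zero]
      exact sum_edgeChar_wedge_right_le T _
  have h2 : ∑ b, (g (b ∆ {x}) + g b) ≤ ∑ _b : Set V, (Fintype.card (Set V) : ℝ) :=
    Finset.sum_le_sum fun b _ => h1 b
  rw [Finset.sum_add_distrib, h0] at h2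
  simp only [Finset.sum_const, Finset.card_univ, nsmul_eq_mul] at h2
  rw [sq]
  linarith

/-- Translation by a random form `b ∧ b'` has spectral gap at least `1 / 2`. -/
theorem sum_mul_symmDiff_wedge_le (f : SimpleGraph V → ℝ) :
    Fintype.card (SimpleGraph V) * ∑ b, ∑ b', ∑ G, f G * f (G ∆ wedge b b') ≤
      (Fintype.card (Set V) : ℝ) ^ 2 / 2 *
        (Fintype.card (SimpleGraph V) * ∑ G, f G ^ 2 + (∑ G, f G) ^ 2) := by
  set B : ℝ := (Fintype.card (Set V) : ℝ) ^ 2 with hB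
  set F : SimpleGraph V → ℝ := fun T => (∑ G, f G * edgeChar T G) ^ 2 with hF
  have hF0 : F ⊥ = (∑ G, f G) ^ 2 := by simp [hF, edgeChar]
  have hFsum : ∑ T, F T = Fintype.card (SimpleGraph V) * ∑ G, f G ^ 2 := by
    have := sum_edgeChar_mul_sq f ⊥
    simpa only [edgeChar_bot, one_mul, symmDiff_bot, ← sq] using this
  have hl : Fintype.card (SimpleGraph V) * ∑ b, ∑ b', ∑ G, f G * f (G ∆ wedge b b') =
      ∑ T, (∑ b, ∑ b', edgeChar T (wedge b b')) * F T := by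
    simp only [Finset.mul_sum (s := (Finset.univ : Finset (Set V))), ← sum_edgeChar_mul_sq,
      Finset.sum_mul]
    rw [Finset.sum_comm' (t' := Finset.univ) (s' := fun _ => Finset.univ) (by simp)]
    simp only [hF]
    rw [Finset.sum_comm]
    conv_rhs => rw [Finset.sum_comm]
    refine Finset.sum_congr rfl fun b _ => ?_
    rw [Finset.sum_comm]
  have hbot : ∑ b : Set V, ∑ b' : Set V, edgeChar (⊥ : SimpleGraph V) (wedge b b') = B := by
    simp [edgeChar, hB, sq]
  -- The trivial character has eigenvalue 1 rather than `1/2`; its excess is the term `(∑ f)²`.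
  rw [hl, ← hFsum, ← hF0, ← Finset.sum_erase_add _ _ (Finset.mem_univ ⊥), hbot,
    ← Finset.sum_erase_add _ F (Finset.mem_univ ⊥)]
  have : ∑ T ∈ Finset.univ.erase ⊥, (∑ b, ∑ b', edgeChar T (wedge b b')) * F T ≤
      ∑ T ∈ Finset.univ.erase ⊥, B / 2 * F T :=
    Finset.sum_le_sum fun T hT => mul_le_mul_of_nonneg_right
      (sum_edgeChar_wedge (Finset.ne_of_mem_erase hT)) (sq_nonneg _)
  rw [← Finset.mul_sum] at this
  linarith

end Fourier

/-! ### Pivots as rank-two updates, and reaching `H` through disjoint pairs -/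

section PivotMinor

variable {V : Type*}

theorem localComplement_induce (G : SimpleGraph V) (W : Set V) (u : W) :
    (G.induce W).localComplement u = (G.localComplement u).induce W := by
  ext x y
  simp [localComplement, Subtype.ext_iff]

theorem pivot_induce (G : SimpleGraph V) (W : Set V) (u v : W) :
    (G.induce W).pivot u v = (G.pivot u v).induce W := by
  simp only [pivot, localComplement_induce]

/-- A pivot toggles the pairs lying in different classes among "adjacent to `v` only", "to `w` only"
and "to both". These are the pairs whose membership vectors are distinct and nonzero, that is, have
determinant 1 modulo 2. -/
theorem pivot_adj_of_ne {G : SimpleGraph V} {v w x y : V} (h : G.Adj v w) (hxv : x ≠ v)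
    (hxw : x ≠ w) (hyv : y ≠ v) (hyw : y ≠ w) :
    (G.pivot v w).Adj x y ↔ (G ∆ wedge (G.neighborSet v) (G.neighborSet w)).Adj x y := by
  have h' := h.symm
  have hne := h.ne
  by_cases hxy : x = y
  · simp [hxy]
  simp only [pivot, localComplement, symmDiff_adj, wedge_adj, mem_neighborSet, xor_def]
  by_cases h1 : G.Adj x y <;> by_cases h2 : G.Adj v x <;> by_cases h3 : G.Adj v y <;>
    by_cases h4 : G.Adj w x <;> by_cases h5 : G.Adj w y <;>
    simp [h, h', hne.symm, hxv.symm, hxw.symm, hyv.symm, hyw.symm, hxy, h1, h2, h3,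
      h4, h5]

/-- Deleting vertices outside of `W` from a graph on `V` that arises from `G` by pivots. -/
theorem IsPivotMinor.induce_sdiff {G G' : SimpleGraph V} {W T : Set V} (hT : T.Finite)
    (h : G.IsPivotMinor W (G'.induce W)) : G.IsPivotMinor (W \ T) (G'.induce (W \ T)) := by
  induction T, hT using Set.Finite.induction_on with
  | empty => rwa [Set.sdiff_empty]
  | @insert a s _ _ ih =>
    by_cases ha : a ∈ W \ s
    · have h2 : W \ insert a s = (W \ s) \ {a} := by
        ext x
        simp only [Set.mem_sdiff, Set.mem_insert_iff, Set.mem_singleton_iff]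
        tauto
      rw [h2]
      exact ih.delete a ha
    · have h2 : W \ insert a s = W \ s := by
        ext x
        simp only [Set.mem_sdiff, Set.mem_insert_iff] at *
        grind
      rwa [h2]

/-- The vertices of `U` together with the vertices of a list of pairs. -/
def pairSupport (U : Set V) : List (V × V) → Set V
  | [] => U
  | p :: l => insert p.1 (insert p.2 (pairSupport U l))

/-- The pairs in the list are disjoint pairs of vertices outside of `U`. -/
def DisjointPairs (U : Set V) : List (V × V) → Prop
  | [] => True
  | p :: l => p.1 ≠ p.2 ∧ p.1 ∉ pairSupport U l ∧ p.2 ∉ pairSupport U l ∧ DisjointPairs U l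

/-- Pivoting successively at some of the pairs of the list, which have to be edges when it is their
turn, turns `G` into a graph that agrees with `H` on `U`. -/
def PairReaches (U : Set V) (H : SimpleGraph V) : List (V × V) → SimpleGraph V → Prop
  | [], G => ∀ x ∈ U, ∀ y ∈ U, G.Adj x y ↔ H.Adj x y
  | p :: l, G =>
    PairReaches U H l G ∨ G.Adj p.1 p.2 ∧ PairReaches U H l (G.pivot p.1 p.2)

theorem PairReaches.isPivotMinor {U : Set V} {H G : SimpleGraph V} {l : List (V × V)}
    (hl : DisjointPairs U l) {G' : SimpleGraph V} (h : PairReaches U H l G')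
    (hG : G.IsPivotMinor (pairSupport U l) (G'.induce (pairSupport U l))) :
    G.IsPivotMinor U (H.induce U) := by
  induction l generalizing G' with
  | nil =>
    have : G'.induce U = H.induce U := by
      ext x y
      exact h x x.2 y y.2
    rwa [← this]
  | cons p l ih =>
    obtain ⟨hne, h1, h2, hl⟩ := hl
    have hS : pairSupport U (p :: l) \ {p.1, p.2} = pairSupport U l := by
      ext x
      simp only [pairSupport, Set.mem_sdiff, Set.mem_insert_iff, Set.mem_singleton_iff]
      grind
    rcases h with h | ⟨hadj, h⟩
    · refine ih hl h ?_
      rw [← hS]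
      exact hG.induce_sdiff (Set.toFinite _)
    · refine ih hl h ?_
      rw [← hS]
      refine IsPivotMinor.induce_sdiff (Set.toFinite _) ?_
      have h3 := hG.pivot ⟨p.1, by simp [pairSupport]⟩ ⟨p.2, by simp [pairSupport]⟩ hadj
      rwa [pivot_induce] at h3

theorem PairReaches.isPivotMinor_of_finite [Finite V] {U : Set V} {H G : SimpleGraph V}
    {l : List (V × V)} (hl : DisjointPairs U l) (h : PairReaches U H l G) :
    G.IsPivotMinor U (H.induce U) := by
  refine h.isPivotMinor hl ?_
  have := IsPivotMinor.induce_sdiff (Set.toFinite (pairSupport U l)ᶜ) (IsPivotMinor.refl (G := G))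
  rwa [← Set.compl_eq_univ_sdiff, compl_compl] at this

/-- Pivots act on all of `V`, with deletions postponed; this locality is what makes success on `l`
independent of the edges at a fresh pair. -/
theorem pairReaches_congr {U : Set V} {H : SimpleGraph V} {l : List (V × V)}
    (hl : DisjointPairs U l) {G G' : SimpleGraph V}
    (h : ∀ x ∈ pairSupport U l, ∀ y ∈ pairSupport U l, G.Adj x y ↔ G'.Adj x y) :
    PairReaches U H l G ↔ PairReaches U H l G' := by
  induction l generalizing G G' with
  | nil =>
    refine forall₂_congr fun x hx => forall₂_congr fun y hy => ?_
    rw [h x hx y hy]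
  | cons p l ih =>
    obtain ⟨v, w⟩ := p
    obtain ⟨hne, h1, h2, hl⟩ := hl
    simp only [pairSupport] at h h1 h2
    have hv : v ∈ insert v (insert w (pairSupport U l)) := by simp
    have hw : w ∈ insert v (insert w (pairSupport U l)) := by simp
    have hs : ∀ x ∈ pairSupport U l, x ∈ insert v (insert w (pairSupport U l)) := by
      intro x hx
      simp [hx]
    refine or_congr (ih hl fun x hx y hy => h x (hs x hx) y (hs y hy)) ?_
    rw [show G.Adj (v, w).1 (v, w).2 ↔ G'.Adj (v, w).1 (v, w).2 from h v hv w hw]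
    refine and_congr_right fun hadj' => ih hl fun x hx y hy => ?_
    have hadj : G.Adj v w := (h v hv w hw).2 hadj'
    have hxv : x ≠ v := by rintro rfl; exact h1 hx
    have hxw : x ≠ w := by rintro rfl; exact h2 hx
    have hyv : y ≠ v := by rintro rfl; exact h1 hy
    have hyw : y ≠ w := by rintro rfl; exact h2 hy
    rw [pivot_adj_of_ne hadj hxv hxw hyv hyw, pivot_adj_of_ne hadj' hxv hxw hyv hyw]
    simp only [symmDiff_adj, wedge_adj, mem_neighborSet, h x (hs x hx) y (hs y hy),
      h v hv x (hs x hx), h v hv y (hs y hy), h w hw x (hs x hx), h w hw y (hs y hy)]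

theorem ncard_pairSupport_le (U : Set V) (l : List (V × V)) :
    (pairSupport U l).ncard ≤ U.ncard + 2 * l.length := by
  induction l with
  | nil => simp [pairSupport]
  | cons p l ih =>
    have h1 := Set.ncard_insert_le p.1 (insert p.2 (pairSupport U l))
    have h2 := Set.ncard_insert_le p.2 (pairSupport U l)
    simp only [pairSupport, List.length_cons]
    omega

theorem exists_disjointPairs [Fintype V] (U : Set V) (m : ℕ)
    (h : U.ncard + 2 * m ≤ Fintype.card V) :
    ∃ l : List (V × V), l.length = m ∧ DisjointPairs U l := by
  induction m with
  | zero => exact ⟨[], rfl, trivial⟩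
  | succ m ih =>
    obtain ⟨l, rfl, hl⟩ := ih (by omega)
    have h1 := ncard_pairSupport_le U l
    have h2 := Set.ncard_add_ncard_compl (pairSupport U l)
    rw [Nat.card_eq_fintype_card] at h2
    obtain ⟨v, hv, w, hw, hne⟩ := (Set.one_lt_ncard (Set.toFinite _)).1
      (show 1 < (pairSupport U l)ᶜ.ncard by omega)
    exact ⟨(v, w) :: l, rfl, hne, hv, hw, hl⟩

end PivotMinor

/-! ### Independence of the edges at a fresh pair -/

section Resampling

variable {V : Type*}

/-- The function `f` depends only on the edges inside of `S`. -/
def IsLocal (S : Set V) (f : SimpleGraph V → ℝ) : Prop :=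
  ∀ G G' : SimpleGraph V, (∀ x ∈ S, ∀ y ∈ S, G.Adj x y ↔ G'.Adj x y) → f G = f G'

variable [Fintype V]

theorem two_mul_sum_ite_adj {v w : V} (hne : v ≠ w) (g : SimpleGraph V → ℝ)
    (hg : ∀ G, g (G ∆ edge v w) = g G) :
    2 * ∑ G, (if G.Adj v w then g G else 0) = ∑ G, g G := by
  have h := Fintype.sum_comp_symmDiff (fun G => if G.Adj v w then g G else 0) (edge v w)
  have h2 : ∀ G : SimpleGraph V, (G ∆ edge v w).Adj v w ↔ ¬ G.Adj v w := by
    intro G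
    simp [symmDiff_adj, edge_adj, hne, xor_def]
  simp only [h2, hg] at h
  rw [two_mul]
  nth_rw 1 [← h]
  rw [← Finset.sum_add_distrib]
  refine Finset.sum_congr rfl fun G _ => ?_
  by_cases h3 : G.Adj v w <;> simp [h3]

theorem sum_resample {S : Set V} {f : SimpleGraph V → ℝ} (hf : IsLocal S f) {v w : V}
    (hne : v ≠ w) (hv : v ∉ S) (hw : w ∉ S) :
    (Fintype.card (Set V) : ℝ) ^ 2 *
        ∑ G : SimpleGraph V, f G * f (G ∆ wedge (G.neighborSet v) (G.neighborSet w)) =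
      ∑ b, ∑ b', ∑ G, f G * f (G ∆ wedge b b') := by
  set Ψ : SimpleGraph V → ℝ :=
    fun G => f G * f (G ∆ wedge (G.neighborSet v) (G.neighborSet w)) with hΨ
  -- This translation rewires `v` to `b` and `w` to `b'` inside `S` and leaves the graph induced on
  -- `S` unchanged.
  have key : ∀ (G : SimpleGraph V) (b b' : Set V),
      Ψ (G ∆ (wedge {v} (b ∆ G.neighborSet v) ∆ wedge {w} (b' ∆ G.neighborSet w))) =
        f G * f (G ∆ wedge b b') := by
    intro G b b'
    have hC : ∀ x ∈ S, x ≠ v ∧ x ≠ w := fun x hx =>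
      ⟨by rintro rfl; exact hv hx, by rintro rfl; exact hw hx⟩
    simp only [hΨ]
    congr 1
    · refine hf _ _ fun x hx y hy => ?_
      simp [symmDiff_adj, wedge_adj, hC x hx, hC y hy, xor_def]
    · refine hf _ _ fun x hx y hy => ?_
      have hx1 := (hC x hx).1
      have hx2 := (hC x hx).2
      have hy1 := (hC y hy).1
      have hy2 := (hC y hy).2
      simp only [symmDiff_adj, wedge_adj, mem_neighborSet, Set.mem_singleton_iff, hx1, hx2, hy1,
        hy2, hx1.symm, hx2.symm, hy1.symm, hy2.symm, hne, hne.symm, Set.mem_symmDiff, xor_def,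
        ne_eq, not_false_eq_true, true_and, false_and, and_false, or_false, false_or]
      by_cases h1 : x ∈ b <;> by_cases h2 : y ∈ b <;> by_cases h3 : x ∈ b' <;>
        by_cases h4 : y ∈ b' <;> by_cases h5 : G.Adj v x <;> by_cases h6 : G.Adj v y <;>
        by_cases h7 : G.Adj w x <;> by_cases h8 : G.Adj w y <;>
        simp [h1, h2, h3, h4, h5, h6, h7, h8]
  calc (Fintype.card (Set V) : ℝ) ^ 2 * ∑ G, Ψ G
      = ∑ b : Set V, ∑ b' : Set V, ∑ G, Ψ G := by
        simp only [Finset.sum_const, Finset.card_univ, nsmul_eq_mul]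
        ring
    _ = ∑ b : Set V, ∑ b' : Set V, ∑ G, Ψ (G ∆ (wedge {v} b ∆ wedge {w} b')) := by
        simp only [Fintype.sum_comp_symmDiff Ψ]
    _ = ∑ G, ∑ b : Set V, ∑ b' : Set V, Ψ (G ∆ (wedge {v} b ∆ wedge {w} b')) := by
        symm
        rw [Finset.sum_comm]
        refine Finset.sum_congr rfl fun b _ => ?_
        rw [Finset.sum_comm]
    _ = ∑ G, ∑ b, ∑ b', f G * f (G ∆ wedge b b') := by
        refine Finset.sum_congr rfl fun G _ => ?_
        rw [← Fintype.sum_comp_symmDiff _ (G.neighborSet v)]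
        refine Finset.sum_congr rfl fun b _ => ?_
        rw [← Fintype.sum_comp_symmDiff _ (G.neighborSet w)]
        exact Finset.sum_congr rfl fun b' _ => key G b b'
    _ = ∑ b, ∑ b', ∑ G, f G * f (G ∆ wedge b b') := by
        rw [Finset.sum_comm]
        refine Finset.sum_congr rfl fun b _ => ?_
        rw [Finset.sum_comm]

end Resampling

/-! ### Recurrence for the number of bad graphs -/

section Counting

variable {V : Type*} [Fintype V]

theorem card_filter_not_pairReaches_nil (U : Set V) (H : SimpleGraph V) :
    (#{G | ¬ PairReaches U H [] G} : ℝ) ≤ Fintype.card (SimpleGraph U) *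
      (Fintype.card (SimpleGraph V) - #{G | ¬ PairReaches U H [] G}) := by
  have h1 : (Fintype.card (SimpleGraph V) : ℝ) - #{G | ¬ PairReaches U H [] G} =
      ∑ G, if PairReaches U H [] G then (1 : ℝ) else 0 := by
    rw [Finset.sum_boole, ← Finset.card_univ, sub_eq_iff_eq_add]
    exact_mod_cast (Finset.card_filter_add_card_filter_not (s := Finset.univ) _).symm
  rw [h1]
  calc (#{G | ¬ PairReaches U H [] G} : ℝ) ≤ Fintype.card (SimpleGraph V) := by
        exact_mod_cast Finset.card_le_univ _
    _ = ∑ _G : SimpleGraph V, (1 : ℝ) := by simp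
    _ ≤ ∑ G, ∑ K : SimpleGraph U,
          if PairReaches U H [] (G ∆ K.map (Function.Embedding.subtype _)) then (1 : ℝ) else 0 := by
        refine Finset.sum_le_sum fun G _ => ?_
        -- Every graph has a translate by a graph on `U` that agrees with `H` there, namely by the
        -- difference on `U`.
        refine le_trans ?_ (Finset.single_le_sum (a := (G ∆ H).induce U)
          (fun K _ => by split_ifs <;> norm_num) (Finset.mem_univ _))
        rw [if_pos]
        intro x hx y hy
        rw [symmDiff_adj, map_adj]
        have : (∃ u v, ((G ∆ H).induce U).Adj u v ∧ Function.Embedding.subtype (· ∈ U) u = x ∧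
            Function.Embedding.subtype (· ∈ U) v = y) ↔ (G ∆ H).Adj x y := by
          constructor
          · rintro ⟨u, v, h, rfl, rfl⟩
            exact h
          · exact fun h => ⟨⟨x, hx⟩, ⟨y, hy⟩, h, rfl, rfl⟩
        rw [this, symmDiff_adj]
        simp only [xor_def]
        tauto
    _ = _ := by
        rw [Finset.sum_comm]
        simp only [Fintype.sum_comp_symmDiff (fun G => if PairReaches U H [] G then (1 : ℝ) else 0),
          Finset.sum_const, Finset.card_univ, nsmul_eq_mul]

theorem card_filter_not_pairReaches_cons {U : Set V} {H : SimpleGraph V} {p : V × V}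
    {l : List (V × V)} (hl : DisjointPairs U (p :: l)) :
    4 * Fintype.card (SimpleGraph V) * (#{G | ¬ PairReaches U H (p :: l) G} : ℝ) ≤
      3 * Fintype.card (SimpleGraph V) * #{G | ¬ PairReaches U H l G} +
        (#{G | ¬ PairReaches U H l G} : ℝ) ^ 2 := by
  obtain ⟨v, w⟩ := p
  obtain ⟨hne, hv, hw, hl⟩ := hl
  simp only at hne hv hw
  set f : SimpleGraph V → ℝ := fun G => if ¬ PairReaches U H l G then 1 else 0 with hf
  have hloc : IsLocal (pairSupport U l) f := fun G G' h => by
    simp only [hf, pairReaches_congr hl h]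
  have hfsq : ∀ G, f G ^ 2 = f G := fun G => by
    simp only [hf]
    split_ifs <;> norm_num
  have hS : ∀ x ∈ pairSupport U l, x ≠ v ∧ x ≠ w := fun x hx =>
    ⟨by rintro rfl; exact hv hx, by rintro rfl; exact hw hx⟩
  set Ψ : SimpleGraph V → ℝ :=
    fun G => f G * f (G ∆ wedge (G.neighborSet v) (G.neighborSet w)) with hΨ
  have hnew : ∀ G, (if ¬ PairReaches U H ((v, w) :: l) G then (1 : ℝ) else 0) =
      f G - (if G.Adj v w then f G else 0) + if G.Adj v w then Ψ G else 0 := by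
    intro G
    by_cases hadj : G.Adj v w
    · have h1 : Ψ G = f G * f (G.pivot v w) :=
        congrArg (f G * ·) (hloc _ _ fun x hx y hy => (pivot_adj_of_ne hadj (hS x hx).1
          (hS x hx).2 (hS y hy).1 (hS y hy).2).symm)
      simp only [h1, hf, PairReaches, hadj, if_true]
      by_cases h2 : PairReaches U H l G <;> by_cases h3 : PairReaches U H l (G.pivot v w) <;>
        simp [h2, h3]
    · simp [hf, PairReaches, hadj]
  have hedge : ∀ G : SimpleGraph V, ∀ x ∈ pairSupport U l, ∀ y : V,
      (G ∆ edge v w).Adj y x ↔ G.Adj y x := by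
    intro G x hx y
    simp [symmDiff_adj, edge_adj, xor_def, hS x hx]
  have hfe : ∀ G, f (G ∆ edge v w) = f G := fun G =>
    hloc _ _ fun x _ y hy => hedge G y hy x
  have hΨe : ∀ G, Ψ (G ∆ edge v w) = Ψ G := fun G => by
    simp only [hΨ, hfe]
    congr 1
    refine hloc _ _ fun x hx y hy => ?_
    rw [symmDiff_adj (G ∆ edge v w), hedge G y hy, symmDiff_adj G]
    simp only [wedge_adj, mem_neighborSet, hedge G x hx, hedge G y hy]
  have hA : ∑ G, f G = #{G | ¬ PairReaches U H l G} := by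
    simp only [hf, Finset.sum_boole]
  have hA' : ∑ G, (if ¬ PairReaches U H ((v, w) :: l) G then (1 : ℝ) else 0) =
      #{G | ¬ PairReaches U H ((v, w) :: l) G} := by
    simp only [Finset.sum_boole]
  rw [← hA', ← hA]
  simp only [hnew, Finset.sum_add_distrib, Finset.sum_sub_distrib]
  have e1 := two_mul_sum_ite_adj hne f hfe
  have e2 := two_mul_sum_ite_adj hne Ψ hΨe
  have e3 := sum_mul_symmDiff_wedge_le f
  rw [← sum_resample hloc hne hv hw] at e3
  simp only [hfsq] at e3
  have hB : (0 : ℝ) < (Fintype.card (Set V) : ℝ) ^ 2 := by positivity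
  have e4 : Fintype.card (SimpleGraph V) * ∑ G, Ψ G ≤
      (Fintype.card (SimpleGraph V) * ∑ G, f G + (∑ G, f G) ^ 2) / 2 := by
    refine le_of_mul_le_mul_left ?_ hB
    linarith
  have hN : (0 : ℝ) ≤ Fintype.card (SimpleGraph V) := by positivity
  have e5 : ∑ G, f G - (∑ G, if G.Adj v w then f G else 0) +
      (∑ G, if G.Adj v w then Ψ G else 0) = (∑ G, f G + ∑ G, Ψ G) / 2 := by linarith
  rw [e5]
  linarith

/-- Bounding the odds rather than `q` makes the recurrence linear: `q' ≤ (3q + q²)/4` gives `q'/(1 -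
q') ≤ (3 + q)/(4 + q) * q/(1 - q)`, and `(3 + q)/(4 + q) ≤ 4/5` for `q ≤ 1`. -/
theorem card_filter_not_pairReaches_le {U : Set V} {H : SimpleGraph V}
    {l : List (V × V)} (hl : DisjointPairs U l) :
    (#{G | ¬ PairReaches U H l G} : ℝ) ≤
      Fintype.card (SimpleGraph U) * (4 / 5) ^ l.length *
        (Fintype.card (SimpleGraph V) - #{G | ¬ PairReaches U H l G}) := by
  induction l with
  | nil => simpa using card_filter_not_pairReaches_nil U H
  | cons p l ih =>
    have h1 := card_filter_not_pairReaches_cons (H := H) hl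
    have ih := ih hl.2.2.2
    have h2 : (#{G | ¬ PairReaches U H l G} : ℝ) ≤ Fintype.card (SimpleGraph V) := by
      exact_mod_cast Finset.card_le_univ _
    have h3 : (0 : ℝ) ≤ #{G | ¬ PairReaches U H l G} := by positivity
    have hN : (0 : ℝ) < Fintype.card (SimpleGraph V) := by exact_mod_cast Fintype.card_pos
    rw [List.length_cons, pow_succ]
    set r : ℝ := Fintype.card (SimpleGraph U) * (4 / 5) ^ l.length with hr
    have hr0 : 0 ≤ r := by positivity
    rw [← mul_assoc, ← hr]
    generalize (#{G | ¬ PairReaches U H (p :: l) G} : ℝ) = a' at *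
    generalize (#{G | ¬ PairReaches U H l G} : ℝ) = a at *
    generalize (Fintype.card (SimpleGraph V) : ℝ) = N at *
    have h4 : a * (3 * N + a) ≤ r * (N - a) * (3 * N + a) :=
      mul_le_mul_of_nonneg_right ih (by linarith)
    have h5 : r * (N - a) * (5 * (3 * N + a)) ≤ r * (N - a) * (4 * (4 * N + a)) :=
      mul_le_mul_of_nonneg_left (by linarith) (mul_nonneg hr0 (by linarith))
    have h6 : r * (4 * N * a') ≤ r * (3 * N * a + a ^ 2) := mul_le_mul_of_nonneg_left h1 hr0
    have h7 : 4 * N * a' ≤ 4 * N * (r * (4 / 5) * (N - a')) := by nlinarith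
    exact le_of_mul_le_mul_left h7 (by linarith)

theorem card_filter_not_isPivotMinor_le (U : Set V) (H : SimpleGraph U) :
    (#{G : SimpleGraph V | ¬ G.IsPivotMinor U H} : ℝ) ≤
      Fintype.card (SimpleGraph U) * (4 / 5) ^ ((Fintype.card V - U.ncard) / 2) *
        Fintype.card (SimpleGraph V) := by
  have hU : U.ncard ≤ Fintype.card V := by
    rw [← Nat.card_eq_fintype_card]
    exact Set.ncard_le_card U
  obtain ⟨l, hlen, hl⟩ := exists_disjointPairs U ((Fintype.card V - U.ncard) / 2) (by omega)
  set H' : SimpleGraph V := H.map (Function.Embedding.subtype _) with hH'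
  have hind : H'.induce U = H := comap_map_eq _ _
  have h1 : (#{G : SimpleGraph V | ¬ G.IsPivotMinor U H} : ℝ) ≤
      #{G | ¬ PairReaches U H' l G} := by
    have : Finset.filter (fun G : SimpleGraph V => ¬ G.IsPivotMinor U H) Finset.univ ⊆
        Finset.filter (fun G => ¬ PairReaches U H' l G) Finset.univ := by
      intro G hG
      rw [Finset.mem_filter] at hG ⊢
      refine ⟨Finset.mem_univ _, fun h => hG.2 ?_⟩
      have := h.isPivotMinor_of_finite hl
      rwa [hind] at this
    exact_mod_cast Finset.card_le_card this
  have h2 := card_filter_not_pairReaches_le (H := H') hl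
  rw [hlen] at h2
  refine h1.trans (h2.trans (mul_le_mul_of_nonneg_left ?_ (by positivity)))
  have : (0 : ℝ) ≤ #{G | ¬ PairReaches U H' l G} := by positivity
  linarith

end Counting

/-! ### From counting to probability, and the union bound -/

section Uniform

variable {V : Type*} [Fintype V]

open MeasureTheory

theorem binomialRandom_oneHalf_real (S : Set (SimpleGraph V)) :
    (binomialRandom V oneHalf).real S =
      (#{G | G ∈ S} : ℝ) * (1 / 2) ^ (Fintype.card V).choose 2 := by
  have h1 : ∀ G : SimpleGraph V,
      (binomialRandom V oneHalf).real {G} = (1 / 2) ^ (Fintype.card V).choose 2 := by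
    intro G
    have h2 : G.edgeSet.ncard ≤ (Fintype.card V).choose 2 := by
      rw [← coe_edgeFinset, Set.ncard_coe_finset]
      exact card_edgeFinset_le_card_choose_two
    rw [measureReal_def, binomialRandom_singleton, ENNReal.toReal_mul, ENNReal.toReal_pow,
      ENNReal.toReal_pow, Nat.card_eq_fintype_card]
    have h3 : ((unitInterval.toNNReal oneHalf : ENNReal)).toReal = 1 / 2 := by
      simp [oneHalf]
    have h4 : ((unitInterval.toNNReal (unitInterval.symm oneHalf) : ENNReal)).toReal = 1 / 2 := by
      simp [oneHalf]
      norm_num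
    rw [h3, h4, ← pow_add, Nat.add_sub_cancel' h2]
  have h2 : S = ((Finset.univ.filter (· ∈ S) : Finset (SimpleGraph V)) : Set (SimpleGraph V)) := by
    ext; simp
  have : MeasurableSingletonClass (SimpleGraph V) := ⟨fun G => by
    rw [← Set.preimage_image_eq {G} edgeSet_injective]
    exact measurable_edgeSet (Set.toFinite _).measurableSet⟩
  nth_rw 1 [h2]
  rw [← sum_measureReal_singleton, Finset.sum_congr rfl fun G _ => h1 G, Finset.sum_const,
    nsmul_eq_mul]

/-- The total mass 1 of the uniform measure counts the graphs. -/
theorem natCard_simpleGraph :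
    (Nat.card (SimpleGraph V) : ℝ) = 2 ^ (Fintype.card V).choose 2 := by
  have := binomialRandom_oneHalf_real (V := V) Set.univ
  simp only [Set.mem_univ, Finset.filter_true, Finset.card_univ, probReal_univ, one_div,
    inv_pow] at this
  rw [← Nat.card_eq_fintype_card] at this
  field_simp at this
  exact this.symm

theorem card_simpleGraph [Fintype (SimpleGraph V)] :
    (Fintype.card (SimpleGraph V) : ℝ) = 2 ^ (Fintype.card V).choose 2 := by
  rw [← Nat.card_eq_fintype_card, natCard_simpleGraph]

theorem card_filter_encard_eq_le (k : ℕ) :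
    #{U : Set V | U.encard = k} ≤ Fintype.card V ^ k := by
  calc #{U : Set V | U.encard = k}
      ≤ #((Finset.powersetCard k (Finset.univ : Finset V)).image fun s : Finset V => (s : Set V)) := by
        refine Finset.card_le_card fun U hU => ?_
        rw [Finset.mem_filter] at hU
        refine Finset.mem_image.2 ⟨U.toFinset, ?_, by simp⟩
        rw [Finset.mem_powersetCard]
        refine ⟨Finset.subset_univ _, ?_⟩
        have := hU.2
        rw [Set.encard_eq_coe_toFinset_card] at this
        exact_mod_cast this
    _ ≤ #(Finset.powersetCard k (Finset.univ : Finset V)) := Finset.card_image_le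
    _ = (Fintype.card V).choose k := by rw [Finset.card_powersetCard, Finset.card_univ]
    _ ≤ _ := Nat.choose_le_pow _ _

theorem card_filter_not_isPivotMinorUniversal_le (k : ℕ) :
    (#{G : SimpleGraph V | ¬ G.IsPivotMinorUniversal k} : ℝ) ≤
      Fintype.card V ^ k * ((2 ^ k.choose 2) * ((2 ^ k.choose 2) *
        (4 / 5) ^ ((Fintype.card V - k) / 2) * Fintype.card (SimpleGraph V))) := by
  have h1 : (Finset.univ.filter fun G : SimpleGraph V => ¬ G.IsPivotMinorUniversal k) ⊆
      (Finset.univ.filter fun U : Set V => U.encard = k).biUnion fun U =>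
        Finset.univ.biUnion fun H : SimpleGraph U =>
          Finset.univ.filter fun G : SimpleGraph V => ¬ G.IsPivotMinor U H := by
    intro G hG
    simp only [Finset.mem_filter, Finset.mem_univ, true_and, IsPivotMinorUniversal, not_forall,
      Finset.mem_biUnion, exists_prop] at hG ⊢
    exact hG
  have h2 : ∀ U ∈ Finset.univ.filter fun U : Set V => U.encard = k,
      (#(Finset.univ.biUnion fun H : SimpleGraph U =>
          Finset.univ.filter fun G : SimpleGraph V => ¬ G.IsPivotMinor U H) : ℝ) ≤
        (2 ^ k.choose 2) * ((2 ^ k.choose 2) *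
        (4 / 5) ^ ((Fintype.card V - k) / 2) * Fintype.card (SimpleGraph V)) := by
    intro U hU
    have hU : U.encard = k := (Finset.mem_filter.1 hU).2
    have hk : U.ncard = k := by rw [Set.ncard_def, hU, ENat.toNat_natCast]
    have hM : (Fintype.card (SimpleGraph U) : ℝ) = 2 ^ k.choose 2 := by
      rw [card_simpleGraph, ← hk, Set.ncard_eq_toFinset_card', Set.toFinset_card]
    calc (#(Finset.univ.biUnion fun H : SimpleGraph U =>
          Finset.univ.filter fun G : SimpleGraph V => ¬ G.IsPivotMinor U H) : ℝ)
        ≤ ∑ H : SimpleGraph U, (#{G : SimpleGraph V | ¬ G.IsPivotMinor U H} : ℝ) := by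
          exact_mod_cast Finset.card_biUnion_le
      _ ≤ ∑ _H : SimpleGraph U, ((2 ^ k.choose 2) *
            (4 / 5) ^ ((Fintype.card V - k) / 2) * (Fintype.card (SimpleGraph V) : ℝ)) := by
          refine Finset.sum_le_sum fun H _ => ?_
          have := card_filter_not_isPivotMinor_le U H
          rwa [hM, hk] at this
      _ = _ := by rw [Finset.sum_const, nsmul_eq_mul, Finset.card_univ, hM]
  calc (#{G : SimpleGraph V | ¬ G.IsPivotMinorUniversal k} : ℝ)
      ≤ ∑ U : Set V with U.encard = (k : ℕ∞), (#(Finset.univ.biUnion fun H : SimpleGraph U =>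
          Finset.univ.filter fun G : SimpleGraph V => ¬ G.IsPivotMinor U H) : ℝ) := by
        exact_mod_cast (Finset.card_le_card h1).trans Finset.card_biUnion_le
    _ ≤ #{U : Set V | U.encard = k} * ((2 ^ k.choose 2) * ((2 ^ k.choose 2) *
        (4 / 5) ^ ((Fintype.card V - k) / 2) * (Fintype.card (SimpleGraph V) : ℝ))) := by
        refine (Finset.sum_le_sum h2).trans_eq ?_
        rw [Finset.sum_const, nsmul_eq_mul]
    _ ≤ _ := by
        refine mul_le_mul_of_nonneg_right ?_ (by positivity)
        exact_mod_cast card_filter_encard_eq_le k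

theorem one_sub_le_binomialRandom_isPivotMinorUniversal (k : ℕ) :
    1 - (Fintype.card V : ℝ) ^ k * (2 ^ k.choose 2 * 2 ^ k.choose 2) *
        (4 / 5) ^ ((Fintype.card V - k) / 2) ≤
      (binomialRandom V oneHalf).real {G | G.IsPivotMinorUniversal k} := by
  have h1 := card_filter_not_isPivotMinorUniversal_le (V := V) k
  have h2 : (#{G : SimpleGraph V | ¬ G.IsPivotMinorUniversal k} : ℝ) +
      #{G : SimpleGraph V | G.IsPivotMinorUniversal k} =
      Fintype.card (SimpleGraph V) := by
    rw [add_comm, ← Finset.card_univ]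
    exact_mod_cast Finset.card_filter_add_card_filter_not (s := Finset.univ) _
  rw [binomialRandom_oneHalf_real]
  simp only [Set.mem_ofPred_eq]
  rw [card_simpleGraph] at h1 h2
  generalize Fintype.card V = n at *
  have h3 : (0 : ℝ) < (1 / 2) ^ n.choose 2 := by positivity
  have h4 : (2 : ℝ) ^ n.choose 2 * (1 / 2) ^ n.choose 2 = 1 := by
    rw [← mul_pow]; norm_num
  have h5 := mul_le_mul_of_nonneg_right h1 h3.le
  have h6 : (#{G : SimpleGraph V | ¬ G.IsPivotMinorUniversal k} : ℝ) *
      (1 / 2) ^ n.choose 2 + #{G : SimpleGraph V | G.IsPivotMinorUniversal k} *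
      (1 / 2) ^ n.choose 2 = 1 := by rw [← add_mul, h2, h4]
  have h7 : (n : ℝ) ^ k * (2 ^ k.choose 2 * (2 ^ k.choose 2 * (4 / 5) ^ ((n - k) / 2) *
      2 ^ n.choose 2)) * (1 / 2) ^ n.choose 2 =
      (n : ℝ) ^ k * (2 ^ k.choose 2 * 2 ^ k.choose 2) * (4 / 5) ^ ((n - k) / 2) := by
    linear_combination (n : ℝ) ^ k * (2 ^ k.choose 2 * 2 ^ k.choose 2) *
      (4 / 5) ^ ((n - k) / 2) * h4
  linarith

end Uniform

end SimpleGraph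

/-! ### Absorbing the lower-order terms -/

section Asymptotics

open Filter Real

theorem Real.logb_two_sixteen_div_thirteen_mem : 0 < logb 2 (16 / 13) ∧ logb 2 (16 / 13) < 1 ∧
    logb 2 (16 / 13) < logb 2 (5 / 4) := by
  refine ⟨logb_pos (by norm_num) (by norm_num), ?_, ?_⟩
  · rw [logb_lt_iff_lt_rpow (by norm_num) (by norm_num)]
    norm_num
  · exact logb_lt_logb (by norm_num) (by norm_num) (by norm_num)

theorem eventually_sqrt_mul_logb_add_le (a : ℝ) {b : ℝ} (hb : 0 < b) :
    ∀ᶠ n : ℕ in atTop, √n * logb 2 n + a * √n ≤ b * n := by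
  have h1 : ∀ᶠ x : ℝ in atTop, √x * logb 2 x + a * √x ≤ b * x := by
    have hl := (isLittleO_log_rpow_atTop (r := 1 / 2) (by norm_num)).bound
      (show 0 < b / 2 * Real.log 2 by have := Real.log_pos one_lt_two; positivity)
    filter_upwards [hl, eventually_ge_atTop 1, tendsto_sqrt_atTop.eventually_ge_atTop (2 * a / b)]
      with x h1 h2 h3
    have hlog : 0 < Real.log 2 := Real.log_pos one_lt_two
    rw [← sqrt_eq_rpow, norm_of_nonneg (Real.log_nonneg h2), norm_of_nonneg (sqrt_nonneg x)] at h1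
    have h4 : logb 2 x ≤ b / 2 * √x := by
      rw [logb, div_le_iff₀ hlog]
      linarith
    have h5 : a ≤ b / 2 * √x := by
      rw [div_le_iff₀ hb] at h3
      linarith
    have h6 : √x * √x = x := mul_self_sqrt (by linarith)
    have h7 := mul_le_mul_of_nonneg_left (add_le_add h4 h5) (sqrt_nonneg x)
    nlinarith
  exact tendsto_natCast_atTop_atTop.eventually h1

theorem exists_forall_pow_mul_le : ∃ k₀ : ℕ, ∀ c : ℝ, 0 < c → ∀ k n : ℕ, k₀ ≤ k →
    (1 + c) * (2 / logb 2 (16 / 13)) * (k : ℝ) ^ 2 ≤ n →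
    (n : ℝ) ^ k * (2 ^ k.choose 2 * 2 ^ k.choose 2) * (4 / 5) ^ ((n - k) / 2) ≤
      (2 : ℝ) ^ (-(c * (k : ℝ) ^ 2)) := by
  obtain ⟨hL0, hL1, hLL⟩ := Real.logb_two_sixteen_div_thirteen_mem
  set L := logb 2 (16 / 13) with hL
  set L' := logb 2 (5 / 4) with hL'
  obtain ⟨n₀, hn₀⟩ := eventually_atTop.1
    -- The gap between `5/4` and `16/13` pays for `n ^ k` (as `k ≤ √n`) and for the loss `L' * (k +
    -- 1) / 2 ≤ L' * √n` in the exponent.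
    (eventually_sqrt_mul_logb_add_le L' (b := (L' - L) / 2) (by linarith))
  refine ⟨n₀ + 1, fun c hc k n hk h => ?_⟩
  have hk1 : (1 : ℝ) ≤ k := by exact_mod_cast (by omega : 1 ≤ k)
  have h1 : (1 + c) * (k : ℝ) ^ 2 ≤ L / 2 * n := by
    have : (1 + c) * (2 / L) * (k : ℝ) ^ 2 = (2 / L) * ((1 + c) * (k : ℝ) ^ 2) := by ring
    rw [this, div_mul_eq_mul_div, div_le_iff₀ hL0] at h
    linarith
  have hk2 : (k : ℝ) ^ 2 ≤ n := by
    have : 0 ≤ c * (k : ℝ) ^ 2 := by positivity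
    have : L * n ≤ 1 * n := mul_le_mul_of_nonneg_right hL1.le (by positivity)
    have : (0 : ℝ) ≤ n := by positivity
    linarith
  have hkn : k ≤ n := by
    have : (k : ℝ) ≤ n := by nlinarith
    exact_mod_cast this
  have hks : (k : ℝ) ≤ √n := Real.le_sqrt_of_sq_le hk2
  have h2 := hn₀ n (by omega)
  have hn1 : (1 : ℝ) ≤ n := hk1.trans (by exact_mod_cast hkn)
  have hnk : (n : ℝ) ^ k = 2 ^ (k * logb 2 n) := by
    rw [mul_comm, Real.rpow_mul (by norm_num), Real.rpow_logb (by norm_num) (by norm_num)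
      (by linarith), Real.rpow_natCast]
  have hch : (2 : ℝ) ^ k.choose 2 * 2 ^ k.choose 2 ≤ 2 ^ ((k : ℝ) ^ 2) := by
    have : k.choose 2 + k.choose 2 ≤ k ^ 2 := by
      rw [Nat.choose_two_right]
      have := Nat.div_mul_le_self (k * (k - 1)) 2
      have : k * (k - 1) ≤ k * k := Nat.mul_le_mul_left _ (by omega)
      rw [sq]
      omega
    rw [← pow_add]
    refine (pow_le_pow_right₀ (by norm_num) this).trans_eq ?_
    rw [← Real.rpow_natCast]
    push_cast
    rfl
  have hm : ((n : ℝ) - k - 1) / 2 ≤ ((n - k) / 2 : ℕ) := by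
    have h3 : n - k ≤ 2 * ((n - k) / 2) + 1 := by omega
    have h4 : ((n - k : ℕ) : ℝ) ≤ 2 * ((n - k) / 2 : ℕ) + 1 := by exact_mod_cast h3
    rw [Nat.cast_sub hkn] at h4
    linarith
  have h45 : ((4 : ℝ) / 5) ^ ((n - k) / 2) = 2 ^ (-(L' * ((n - k) / 2 : ℕ))) := by
    rw [Real.rpow_neg (by norm_num), Real.rpow_mul (by norm_num), hL',
      Real.rpow_logb (by norm_num) (by norm_num) (by norm_num), Real.rpow_natCast, ← inv_pow]
    norm_num
  calc (n : ℝ) ^ k * (2 ^ k.choose 2 * 2 ^ k.choose 2) * (4 / 5) ^ ((n - k) / 2)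
      ≤ 2 ^ (k * logb 2 n) * 2 ^ ((k : ℝ) ^ 2) * 2 ^ (-(L' * ((n - k) / 2 : ℕ))) := by
        rw [hnk, h45]
        gcongr
    _ = 2 ^ (k * logb 2 n + (k : ℝ) ^ 2 + -(L' * ((n - k) / 2 : ℕ))) := by
        rw [Real.rpow_add (by norm_num), Real.rpow_add (by norm_num)]
    _ ≤ 2 ^ (-(c * (k : ℝ) ^ 2)) := by
        refine Real.rpow_le_rpow_of_exponent_le (by norm_num) ?_
        have e1 : k * logb 2 n ≤ √n * logb 2 n :=
          mul_le_mul_of_nonneg_right hks (Real.logb_nonneg (by norm_num) hn1)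
        have e2 := mul_le_mul_of_nonneg_left hm (show 0 ≤ L' by linarith)
        have e3 := mul_le_mul_of_nonneg_left (hk1.trans hks) (show 0 ≤ L' by linarith)
        have e4 := mul_le_mul_of_nonneg_left hks (show 0 ≤ L' by linarith)
        linarith

end Asymptotics

end

theorem mainTheorem3 (c : ℝ) (hc : 0 < c) :
    ∃ ε : ℕ → ℝ, Filter.Tendsto ε Filter.atTop (nhds 0) ∧
      ∀ k n : ℕ, (1 + c) * (2 / Real.logb 2 (16 / 13)) * (k : ℝ) ^ 2 ≤ (n : ℝ) →
        1 - (2 : ℝ) ^ (-((1 + ε k) * c * (k : ℝ) ^ 2)) ≤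
          (SimpleGraph.binomialRandom (Fin n) oneHalf).real
            {G : SimpleGraph (Fin n) | G.IsPivotMinorUniversal k} := by
  obtain ⟨k₀, hk₀⟩ := exists_forall_pow_mul_le
  -- With `ε k = -1` the claimed lower bound is `1 - 2 ^ 0 = 0`, so small `k` are trivial; `k₀` does
  -- not depend on `c`.
  refine ⟨fun k => if k < k₀ then -1 else 0, ?_, fun k n h => ?_⟩
  · refine tendsto_const_nhds.congr' ?_
    filter_upwards [Filter.eventually_ge_atTop k₀] with k hk
    rw [if_neg (by omega)]
  · by_cases hk : k < k₀
    · simp [hk, MeasureTheory.measureReal_nonneg]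
    · have h1 := hk₀ c hc k n (by omega) h
      have h2 := SimpleGraph.one_sub_le_binomialRandom_isPivotMinorUniversal (V := Fin n) k
      rw [Fintype.card_fin] at h2
      simp only [hk, if_false, add_zero, one_mul]
      linarith
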